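/- **Theorem 1.2.** Let $p$ be an odd prime and let $(\frac{\cdot}{p})$ be the Legendre symbol. For a $p$-adic integer $y$ let $\{y\}_p\in\{0,\dots,p-1\}$ denote its least nonnegative residue modulo $p$, and for a $p$-adic integer $x$ let $N_p(x)=|\{1\le k\le (p-1)/2:\ \{kx\}_p>k\}|$. For $a,b,c\in\mathbb Z$ put $\Delta=b^2-4ac$ and $$P(a,b,c)=\prod_{\substack{1\le i<j\le p-1\\ p\nmid ai^2+bij+cj^2}}(ai^2+bij+cj^2),\qquad Q(a,b,c)=\prod_{\substack{1\le i,j\le (p-1)/2\\ p\nmid ai^2+bij+cj^2}}(ai^2+bij+cj^2).$$ (Empty products are $1$.) (i) If $p\equiv 1\pmod 4$, then $$\prod_{\substack{1\le i<j\le (p-1)/2\\ p\nmid i^2+j^2}}(i^2+j^2)\equiv(-1)^{\lfloor (p-5)/8\rfloor}\pmod p.$$ (ii) Let $a,b,c\in\mathbb Z$ with $ac(a+b+c)\not\equiv0\pmod p$. Then, modulo $p$, $$P(a,b,c)\equiv\begin{cases}\left(\frac{a(a+b+c)}p\right)&\text{if }p\mid\Delta,\\ -\left(\frac{ac(a+b+c)\Delta}p\right)&\text{if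 }p\nmid\Delta.\end{cases}$$ If moreover $a+c=0$, then, modulo $p$ and for one of the two choices of the sign, $$Q(a,b,c)\equiv\begin{cases}\pm\frac{p-1}2!&\text{if }(\frac{\Delta}p)=-1\text{, or }p\mid\Delta\text{ and }(\frac{2b}p)=1,\\ \pm1&\text{if }(\frac{\Delta}p)=1\text{, or }p\mid\Delta\text{ and }(\frac{2b}p)=-1.\end{cases}$$ (iii) Let $a,b,c\in\mathbb Z$ with $p\nmid ac$ and $p\mid a+b+c$. Then, modulo $p$, $$P(a,b,c)\equiv\begin{cases}(-1)^{N_p(a/c)}\left(\frac{2c(a-c)}p\right)&\text{if }p\nmid a-c,\\ (-1)^{(p+1)/2}\left(\frac ap\right)&\text{if }p\mid a-c.\end{cases}$$ (iv) Let $a,b,c\in\mathbb Z$ with $p\mid ac$. Then, modulo $p$, $$P(a,b,c)\equiv\begin{cases}-\left(\frac bp\right)&\text{if }p\mid a,\ p\nmid b,\ p\mid c,\\ -\left(\frac cp\right)&\text{if }p\mid a,\ p\nmid bc,\ p\mid b+c,\\ (-1)^{N_p(-c/b)}\left(\frac2p\right)&\text{if }p\mid a,\ p\nmid bc(b+c),\\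 (-1)^{(p+1)/2}\left(\frac cp\right)&\text{if }p\mid a,\ p\mid b,\ p\nmid c,\\ (-1)^{(p+1)/2}\left(\frac ap\right)&\text{if }p\nmid a,\ p\mid b,\ p\mid c,\\ (-1)^{(p+1)/2}\left(\frac bp\right)&\text{if }p\nmid ab,\ p\mid a+b,\ p\mid c,\\ (-1)^{N_p(-a/b)}\left(\frac2p\right)&\text{if }p\nmid ab(a+b),\ p\mid c.\end{cases}$$ -/

import Mathlib

/-- The value `a i² + b i j + c j²` of a binary quadratic form at `(i, j)`. -/
def quadVal (a b c : ℤ) (i j : ℕ) : ℤ :=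
  a * (i : ℤ) ^ 2 + b * (i : ℤ) * (j : ℤ) + c * (j : ℤ) ^ 2

/-- The product of all `f i j` over the pairs `1 ≤ i < j ≤ m` with `p ∤ f i j`. -/
def triProd (p m : ℕ) (f : ℕ → ℕ → ℤ) : ℤ :=
  ∏ x ∈ (Finset.Icc 1 m ×ˢ Finset.Icc 1 m).filter
    (fun x => x.1 < x.2 ∧ ¬ (p : ℤ) ∣ f x.1 x.2), f x.1 x.2

/-- The product of all `f i j` over the pairs `1 ≤ i ≤ m`, `1 ≤ j ≤ m` with `p ∤ f i j`. -/
def boxProd (p m : ℕ) (f : ℕ → ℕ → ℤ) : ℤ :=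
  ∏ x ∈ (Finset.Icc 1 m ×ˢ Finset.Icc 1 m).filter
    (fun x => ¬ (p : ℤ) ∣ f x.1 x.2), f x.1 x.2

/-- `N_p(x) = #{1 ≤ k ≤ (p - 1) / 2 : {k x}_p > k}` for a `p`-adic integer `x`, where
`{y}_p = y.zmodRepr` is the least nonnegative residue of `y` modulo `p`. -/
noncomputable def gaussCount (p : ℕ) [Fact p.Prime] (x : ℤ_[p]) : ℕ :=
  ((Finset.Icc 1 ((p - 1) / 2)).filter
    (fun k : ℕ => k < ((k : ℤ_[p]) * x).zmodRepr)).card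

/-- The quotient `a / c` as a `p`-adic integer, for integers `a`, `c` with `p ∤ c`. -/
noncomputable def padicQuot (p : ℕ) [Fact p.Prime] (a c : ℤ) : ℤ_[p] :=
  (a : ℤ_[p]) * (c : ℤ_[p]).inv

/-- The defining property of the quotient `a / c`. -/
theorem padicQuot_mul (p : ℕ) [Fact p.Prime] (a c : ℤ) (hc : ¬ (p : ℤ) ∣ c) :
    padicQuot p a c * (c : ℤ_[p]) = (a : ℤ_[p]) := by
  have h : ‖(c : ℤ_[p])‖ = 1 := by
    refine le_antisymm (PadicInt.norm_le_one _) (not_lt.1 fun h => hc ?_)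
    exact (PadicInt.norm_int_lt_one_iff_dvd c).1 h
  rw [padicQuot, mul_assoc, PadicInt.inv_mul h, mul_one]

/-!
Write `p = 2 n + 1` and compute in `ZMod p`, where `z ^ n` is the quadratic character of `z`.

*Triangular products.* A pair `i < j` is determined by `i` and the ratio `r = j / i ≠ 0, 1`, and its
value is `i² h(r)` with `h(r) = a + b r + c r²`. For fixed `r` the admissible `i` are those with
`i < {r i}`; negation reverses the order of least residues, so they form a half system: exactly one
of `x`, `-x` is admissible. A half system has `n` elements and, by Wilson, the product of their
squares is `-(-1) ^ n`, so every ratio with `h(r) ≠ 0` contributes the sign `-(-h(r)) ^ n`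
(`triProd_cast_eq_prod_signFactor`). The product of these signs over *all* `r` is found by
completing the square and cancelling `s` against `-s` (`prod_signFactor_quadratic`); the excluded
ratios `0` and `1` account for the characters of `a` and `a + b + c` (`triProd_cast`).

*The counts `N_p`.* Since `{k x} + {k (1 - x)}` is `k` or `k + p`, the latter exactly when
`{k x} > k`, Gauss' lemma for `x` and for `1 - x` gives `(-1) ^ N_p(x) = (2 x (1 - x)) ^ n`
(`neg_one_pow_gaussCount`).

*The box product.* If `a + c = 0`, then `f(y, x) = -f(x, -y)`. Hence the square of the box product
is, up to `(-1) ^ M` with `M` the number of its factors, the product over a half system of `x` and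
all `y ≠ 0`, which the ratios `y / x` evaluate as before (`boxProd_mul_self`); `M` comes from
counting roots of the form. The square is `1` or `-(-1) ^ n = (n!)²`, which fixes the product up
to sign.

*Sums of two squares.* For `p = 4 (l + 1) + 1` let `ζ` generate the group of nonzero squares. The
unordered pairs of distinct squares with nonzero sum are the `{u, u ζ ^ k}` with `1 ≤ k ≤ l`, so the
product is `(-1) ^ l B ^ n` with `B = ∏ (1 + ζ ^ k)` (`triProd_cast_sum_sq_eq_prod`). From
`∏ (1 - ζ ^ k) = n` one gets `B ^ 2` (`prod_one_add_pow_sq`), and `n` is even.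
-/

open Finset

/-! ### Half systems -/

/-- A half system modulo `p`: a set of nonzero residues containing exactly one of `x`, `-x` for
each `x ≠ 0`. -/
def IsHalfSystem {p : ℕ} (S : Finset (ZMod p)) : Prop :=
  0 ∉ S ∧ ∀ x : ZMod p, x ≠ 0 → (x ∈ S ↔ -x ∉ S)

section Foundations

variable {p n : ℕ} [Fact p.Prime]

@[to_additive]
theorem IsHalfSystem.prod_erase_zero {M : Type*} [CommMonoid M] {S : Finset (ZMod p)}
    (hS : IsHalfSystem S) (g : ZMod p → M) :
    ∏ x ∈ univ.erase 0, g x = ∏ x ∈ S, g x * g (-x) := by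
  rw [prod_mul_distrib, ← prod_filter_mul_prod_filter_not (univ.erase 0) (· ∈ S)]
  congr 1
  · refine prod_congr ?_ fun _ _ => rfl
    ext x
    simp only [mem_filter, mem_erase, mem_univ, and_true]
    exact ⟨fun h => h.2, fun h => ⟨fun h0 => hS.1 (h0 ▸ h), h⟩⟩
  · refine prod_nbij' (fun x => -x) (fun x => -x) ?_ ?_ ?_ ?_ ?_
    · intro x hx
      simp only [mem_filter, mem_erase, mem_univ, and_true] at hx
      by_contra h
      exact hx.2 ((hS.2 x hx.1).2 h)
    · intro x hx
      have hx0 : x ≠ 0 := fun h0 => hS.1 (h0 ▸ hx)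
      simp only [mem_filter, mem_erase, mem_univ, and_true]
      exact ⟨neg_ne_zero.2 hx0, (hS.2 x hx0).1 hx⟩
    all_goals simp

theorem IsHalfSystem.card_eq (hn : p = 2 * n + 1) {S : Finset (ZMod p)} (hS : IsHalfSystem S) :
    #S = n := by
  have h := hS.sum_erase_zero (fun _ => (1 : ℕ))
  simp only [sum_const, card_erase_of_mem (mem_univ _), card_univ, ZMod.card, smul_eq_mul] at h
  omega

theorem prod_erase_zero_eq_neg_one : ∏ x ∈ univ.erase (0 : ZMod p), x = -1 := by
  have h := congrArg (Units.val : (ZMod p)ˣ → ZMod p)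
    (FiniteField.prod_univ_units_id_eq_neg_one (K := ZMod p))
  rw [Units.coe_prod, Units.val_neg, Units.val_one] at h
  rw [← h]
  symm
  refine prod_bij' (fun u _ => (u : ZMod p)) (fun x hx => Units.mk0 x (ne_of_mem_erase hx))
    ?_ ?_ ?_ ?_ ?_ <;> simp

theorem IsHalfSystem.prod_sq (hn : p = 2 * n + 1) {S : Finset (ZMod p)} (hS : IsHalfSystem S) :
    ∏ x ∈ S, x ^ 2 = -(-1) ^ n := by
  have h := hS.prod_erase_zero (fun x => x)
  have h2 : ∀ x : ZMod p, x * -x = (-1) * x ^ 2 := fun x => by ring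
  simp only [prod_erase_zero_eq_neg_one, h2, prod_mul_distrib, prod_const, hS.card_eq hn] at h
  have h3 : ((-1 : ZMod p) ^ n) * (-1) ^ n = 1 := by rw [← mul_pow]; simp
  linear_combination (-1 : ZMod p) ^ n * (-h) - (∏ x ∈ S, x ^ 2) * h3

theorem pow_half_sq (hn : p = 2 * n + 1) {z : ZMod p} (hz : z ≠ 0) : z ^ n * z ^ n = 1 := by
  rw [← pow_add, ← two_mul, ← ZMod.pow_card_sub_one_eq_one hz]
  congr 1
  omega

theorem two_ne_zero_of_odd (hn : p = 2 * n + 1) : (2 : ZMod p) ≠ 0 := by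
  have : Fact (2 < p) := ⟨by have := (Fact.out : p.Prime).two_le; omega⟩
  exact Ring.two_ne_zero (by rw [ZMod.ringChar_zmod_n]; omega)

theorem neg_ne_self_of_ne_zero (hn : p = 2 * n + 1) {x : ZMod p} (hx : x ≠ 0) : -x ≠ x := by
  intro h
  have h2 : 2 * x = 0 := by linear_combination -h
  exact (mul_ne_zero (two_ne_zero_of_odd hn) hx) h2

/-- For `r ≠ 0, 1` the residues `x` with `{x} < {r x}` form a half system, because negation
reverses the order of nonzero least residues. -/
theorem isHalfSystem_val_lt {r : ZMod p} (hr0 : r ≠ 0) (hr1 : r ≠ 1) :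
    IsHalfSystem ({x : ZMod p | x.val < (r * x).val} : Finset (ZMod p)) := by
  refine ⟨by simp, fun x hx => ?_⟩
  have hrx : r * x ≠ 0 := mul_ne_zero hr0 hx
  have h1 : (r * x).val ≠ x.val := fun h => by
    have := ZMod.val_injective p h
    exact hr1 (mul_right_cancel₀ hx (by rw [this, one_mul]))
  have : NeZero x := ⟨hx⟩
  have : NeZero (r * x) := ⟨hrx⟩
  simp only [mem_filter, mem_univ, true_and, mul_neg, ZMod.val_neg_of_ne_zero]
  have := ZMod.val_lt x
  have := ZMod.val_lt (r * x)
  omega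

/-- The residues of `1, …, n` form a half system. -/
theorem isHalfSystem_val_le (hn : p = 2 * n + 1) :
    IsHalfSystem ({x : ZMod p | x ≠ 0 ∧ x.val ≤ n} : Finset (ZMod p)) := by
  refine ⟨by simp, fun x hx => ?_⟩
  have : NeZero x := ⟨hx⟩
  simp only [mem_filter, mem_univ, true_and, ne_eq, neg_eq_zero, hx, not_false_eq_true,
    ZMod.val_neg_of_ne_zero]
  have := ZMod.val_lt x
  omega

/-- The sign contributed by a residue `z` to the products below: `-(-z / p)` as an element of
`ZMod p`, except that `z = 0`, whose factor is left out of the products, contributes `1`. -/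
def signFactor (n : ℕ) (z : ZMod p) : ZMod p := if z = 0 then 1 else -(-z) ^ n

theorem signFactor_zero : signFactor n (0 : ZMod p) = 1 := if_pos rfl

theorem signFactor_of_ne {z : ZMod p} (hz : z ≠ 0) : signFactor n z = -(-z) ^ n := if_neg hz

theorem signFactor_mul_self (hn : p = 2 * n + 1) (z : ZMod p) :
    signFactor n z * signFactor n z = 1 := by
  by_cases hz : z = 0
  · simp [hz, signFactor_zero]
  · rw [signFactor_of_ne hz, neg_mul_neg, pow_half_sq hn (neg_ne_zero.2 hz)]

/-- A half system contributes one sign to a product of values `x² z`. -/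
theorem IsHalfSystem.prod_sq_mul (hn : p = 2 * n + 1) {S : Finset (ZMod p)} (hS : IsHalfSystem S)
    {z : ZMod p} (hz : z ≠ 0) : ∏ x ∈ S, x ^ 2 * z = signFactor n z := by
  rw [prod_mul_distrib, hS.prod_sq hn, prod_const, hS.card_eq hn, signFactor_of_ne hz,
    neg_pow z]
  ring

/-! ### Triangular products sorted by ratio -/

/-- Sorting the pairs `i < j` by the ratio `r = j / i` turns the triangular product into a product
of one sign for every `r ≠ 0, 1`. -/
theorem triProd_cast_eq_prod_signFactor (hn : p = 2 * n + 1) (a b c : ℤ) :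
    (triProd p (p - 1) (quadVal a b c) : ZMod p)
      = ∏ r ∈ (univ.erase (0 : ZMod p)).erase 1,
          signFactor n ((a : ZMod p) + (b : ZMod p) * r + (c : ZMod p) * r ^ 2) := by
  set h : ZMod p → ZMod p := fun r => (a : ZMod p) + (b : ZMod p) * r + (c : ZMod p) * r ^ 2 with hh
  have hcast : ∀ i : ℕ, 1 ≤ i → i ≤ p - 1 → ((i : ZMod p) ≠ 0 ∧ (i : ZMod p).val = i) := by
    intro i h1 h2
    have hv : (i : ZMod p).val = i := ZMod.val_cast_of_lt (by omega)
    refine ⟨fun h0 => ?_, hv⟩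
    rw [h0, ZMod.val_zero] at hv
    omega
  have hval : ∀ x : ZMod p, x ≠ 0 → 1 ≤ x.val ∧ x.val ≤ p - 1 := fun x hx => by
    have := ZMod.val_lt x
    have := ZMod.val_pos.2 hx
    omega
  have hq : ∀ i j : ℕ, (i : ZMod p) ≠ 0 →
      ((quadVal a b c i j : ℤ) : ZMod p) = (i : ZMod p) ^ 2 * h ((j : ZMod p) / i) := by
    intro i j hi
    simp only [quadVal, hh]
    push_cast
    field_simp
  have key : (triProd p (p - 1) (quadVal a b c) : ZMod p)
      = ∏ y ∈ ((univ.erase (0 : ZMod p)).erase 1 ×ˢ univ).filter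
          (fun y : ZMod p × ZMod p => h y.1 ≠ 0 ∧ y.2.val < (y.1 * y.2).val),
          y.2 ^ 2 * h y.1 := by
    rw [triProd, Int.cast_prod]
    refine prod_nbij' (fun x => ((x.2 : ZMod p) / x.1, (x.1 : ZMod p)))
      (fun y => (y.2.val, (y.1 * y.2).val)) ?_ ?_ ?_ ?_ ?_
    · rintro ⟨i, j⟩ hx
      simp only [mem_filter, mem_product, mem_Icc] at hx
      obtain ⟨⟨⟨hi1, hi2⟩, hj1, hj2⟩, hij, hf⟩ := hx
      obtain ⟨hi0, hiv⟩ := hcast i hi1 hi2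
      obtain ⟨hj0, hjv⟩ := hcast j hj1 hj2
      rw [← ZMod.intCast_zmod_eq_zero_iff_dvd, hq i j hi0] at hf
      simp only [mem_filter, mem_product, mem_erase, mem_univ, and_true, ne_eq]
      refine ⟨⟨fun h1 => ?_, div_ne_zero hj0 hi0⟩, fun h0 => hf (by rw [h0, mul_zero]), ?_⟩
      · rw [div_eq_one_iff_eq hi0] at h1
        rw [h1, hiv] at hjv
        omega
      · rw [div_mul_cancel₀ _ hi0, hiv, hjv]
        exact hij
    · rintro ⟨r, x⟩ hy
      simp only [mem_filter, mem_product, mem_erase, mem_univ, and_true, ne_eq] at hy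
      obtain ⟨⟨hr1, hr0⟩, hr, hlt⟩ := hy
      have hx : x ≠ 0 := fun h0 => by simp [h0] at hlt
      simp only [mem_filter, mem_product, mem_Icc]
      refine ⟨⟨hval x hx, hval _ (mul_ne_zero hr0 hx)⟩, hlt, ?_⟩
      rw [← ZMod.intCast_zmod_eq_zero_iff_dvd, hq _ _ (by simpa using hx)]
      simp only [ZMod.natCast_val, ZMod.cast_id', id_eq, mul_div_cancel_right₀ _ hx]
      exact mul_ne_zero (pow_ne_zero 2 hx) hr
    · rintro ⟨i, j⟩ hx
      simp only [mem_filter, mem_product, mem_Icc] at hx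
      obtain ⟨⟨⟨hi1, hi2⟩, hj1, hj2⟩, hij, hf⟩ := hx
      obtain ⟨hi0, hiv⟩ := hcast i hi1 hi2
      obtain ⟨hj0, hjv⟩ := hcast j hj1 hj2
      simp only [div_mul_cancel₀ _ hi0, hiv, hjv]
    · rintro ⟨r, x⟩ hy
      simp only [mem_filter, mem_product, mem_erase, mem_univ, and_true, ne_eq] at hy
      have hx : x ≠ 0 := fun h0 => by simp [h0] at hy
      simp [mul_div_cancel_right₀ _ hx]
    · rintro ⟨i, j⟩ hx
      simp only [mem_filter, mem_product, mem_Icc] at hx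
      exact hq i j (hcast i hx.1.1.1 hx.1.1.2).1
  rw [key, prod_filter, prod_product]
  refine prod_congr rfl fun r hr => ?_
  simp only [mem_erase, mem_univ, and_true] at hr
  change _ = signFactor n (h r)
  by_cases h0 : h r = 0
  · simp [h0, signFactor_zero]
  · simp only [h0, ne_eq, not_false_eq_true, true_and]
    rw [← prod_filter, (isHalfSystem_val_lt hr.2 hr.1).prod_sq_mul hn h0]

/-! ### The product of the signs over all ratios -/

theorem prod_signFactor_quadratic (hn : p = 2 * n + 1) {a b c : ZMod p} (hc : c ≠ 0) :
    ∏ r, signFactor n (a + b * r + c * r ^ 2)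
      = if b ^ 2 - 4 * a * c = 0 then 1 else -(c * (b ^ 2 - 4 * a * c)) ^ n := by
  have h2 := two_ne_zero_of_odd hn
  set D := b ^ 2 - 4 * a * c with hD
  -- Completing the square: `4 c h(r) = s² - D` with `s = 2 c r + b`, and `4` is a square.
  have hs : ∀ r : ZMod p, signFactor n (a + b * r + c * r ^ 2)
      = signFactor n (c * ((2 * c * r + b) ^ 2 - D)) := by
    intro r
    have he : c * ((2 * c * r + b) ^ 2 - D) = (2 * c) ^ 2 * (a + b * r + c * r ^ 2) := by
      rw [hD]; ring
    have h2c : (2 * c) ≠ 0 := mul_ne_zero h2 hc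
    rw [he]
    by_cases h0 : a + b * r + c * r ^ 2 = 0
    · rw [h0, mul_zero]
    · rw [signFactor_of_ne h0, signFactor_of_ne (mul_ne_zero (pow_ne_zero 2 h2c) h0), ← mul_neg,
        mul_pow, pow_right_comm, pow_two (_ ^ n), pow_half_sq hn h2c, one_mul]
  have hbij : Function.Bijective (fun r : ZMod p => 2 * c * r + b) := by
    apply Function.Injective.bijective_of_finite
    intro x y hxy
    exact mul_left_cancel₀ (mul_ne_zero h2 hc) (add_right_cancel hxy)
  rw [Fintype.prod_bijective _ hbij _ (fun s => signFactor n (c * (s ^ 2 - D))) hs,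
    ← mul_prod_erase univ _ (mem_univ 0),
    -- The factors at `s` and `-s` are equal signs, so only `s = 0` matters.
    (isHalfSystem_val_le hn).prod_erase_zero]
  rw [prod_eq_one fun s _ => by rw [neg_sq, signFactor_mul_self hn], mul_one]
  by_cases h0 : D = 0
  · simp [h0, signFactor_zero]
  · rw [if_neg h0, signFactor_of_ne (by simpa [hc] using h0)]
    congr 2
    ring

theorem prod_signFactor_linear (hn : p = 2 * n + 1) {a b : ZMod p} (hb : b ≠ 0) :
    ∏ r, signFactor n (a + b * r) = (-1) ^ n := by
  have hbij : Function.Bijective (fun r : ZMod p => a + b * r) := by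
    apply Function.Injective.bijective_of_finite
    intro x y hxy
    exact mul_left_cancel₀ hb (add_left_cancel hxy)
  rw [Fintype.prod_bijective _ hbij _ (fun s => signFactor n s) fun _ => rfl,
    ← mul_prod_erase univ _ (mem_univ 0), signFactor_zero, one_mul]
  have h1 : ∀ s ∈ univ.erase (0 : ZMod p), signFactor n s = (-(-1) ^ n) * s ^ n := by
    intro s hs
    rw [signFactor_of_ne (ne_of_mem_erase hs), neg_pow]
    ring
  rw [prod_congr rfl h1, prod_mul_distrib, prod_pow, prod_erase_zero_eq_neg_one, prod_const,
    card_erase_of_mem (mem_univ _), card_univ, ZMod.card, show p - 1 = 2 * n by omega, pow_mul,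
    neg_sq, pow_two, pow_half_sq hn (neg_ne_zero.2 one_ne_zero), one_pow, one_mul]

theorem prod_signFactor_const {a : ZMod p} :
    ∏ _r : ZMod p, signFactor n a = signFactor n a := by
  rw [prod_const, card_univ, ZMod.card, ZMod.pow_card]

/-- The excluded ratios `0` and `1` carry the signs of `a` and `a + b + c`. -/
theorem triProd_cast (hn : p = 2 * n + 1) (a b c : ℤ) :
    (triProd p (p - 1) (quadVal a b c) : ZMod p)
      = (∏ r, signFactor n ((a : ZMod p) + (b : ZMod p) * r + (c : ZMod p) * r ^ 2))
          * signFactor n (a : ZMod p)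
          * signFactor n ((a : ZMod p) + (b : ZMod p) + (c : ZMod p)) := by
  rw [triProd_cast_eq_prod_signFactor hn, ← mul_prod_erase univ _ (mem_univ 0),
    ← mul_prod_erase (univ.erase 0) _ (mem_erase.2 ⟨one_ne_zero, mem_univ _⟩)]
  have h0 := signFactor_mul_self hn (a : ZMod p)
  have h1 := signFactor_mul_self hn ((a : ZMod p) + (b : ZMod p) + (c : ZMod p))
  simp only [mul_zero, add_zero, mul_one, one_pow, ne_eq, OfNat.ofNat_ne_zero, not_false_eq_true,
    zero_pow]
  set R := ∏ r ∈ (univ.erase (0 : ZMod p)).erase 1,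
          signFactor n ((a : ZMod p) + (b : ZMod p) * r + (c : ZMod p) * r ^ 2)
  linear_combination (-R * signFactor n ((a : ZMod p) + (b : ZMod p) + (c : ZMod p)) ^ 2) * h0
    - R * h1

end Foundations

/-! ### A Gauss lemma for `gaussCount` -/

section GaussCount

variable {p n : ℕ} [Fact p.Prime]

theorem neg_one_pow_val (hn : p = 2 * n + 1) (y : ZMod p) :
    (-1 : ZMod p) ^ y.val = (if y.val ≤ n then 1 else -1) * (-1) ^ y.valMinAbs.natAbs := by
  have hp2 : p / 2 = n := by omega
  have hlt := ZMod.val_lt y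
  rw [ZMod.valMinAbs_natAbs_eq_min]
  split_ifs with h
  · rw [min_eq_left (by omega), one_mul]
  · rw [min_eq_right (by omega), ← pow_succ']
    -- `y.val` and `p - y.val + 1` have the same parity since `p` is odd.
    have h2 : Even (y.val + (p - y.val + 1)) := ⟨n + 1, by omega⟩
    have h3 : (-1 : ZMod p) ^ y.val * (-1) ^ (p - y.val + 1) = 1 := by
      rw [← pow_add, h2.neg_one_pow]
    have h4 : (-1 : ZMod p) ^ y.val * (-1) ^ y.val = 1 := by rw [← mul_pow]; simp
    linear_combination (-1 : ZMod p) ^ (p - y.val + 1) * h4 - (-1 : ZMod p) ^ y.val * h3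

/-- Gauss' lemma in terms of the parity of the least residues `{k y}`, `1 ≤ k ≤ n`. -/
theorem prod_neg_one_pow_val_mul (hn : p = 2 * n + 1) {y : ZMod p} (hy : y ≠ 0) :
    ∏ k ∈ Icc 1 n, (-1 : ZMod p) ^ (y * (k : ZMod p)).val = y ^ n * (-1) ^ ∑ k ∈ Icc 1 n, k := by
  have hp2 : p / 2 = n := by omega
  have hIco : Ico 1 n.succ = Icc 1 n := rfl
  have hmin : ∏ k ∈ Icc 1 n, (-1 : ZMod p) ^ (y * (k : ZMod p)).valMinAbs.natAbs
      = ∏ k ∈ Icc 1 n, (-1 : ZMod p) ^ k := by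
    have h := congrArg (fun s => (s.map fun k => (-1 : ZMod p) ^ k).prod)
      (ZMod.Ico_map_valMinAbs_natAbs_eq_Ico_map_id p y hy)
    simp only [hp2, hIco, Multiset.map_map, Function.comp_def] at h
    exact h
  have hg := ZMod.gauss_lemma_aux p (a := (y.val : ℤ)) (by simpa using hy)
  simp only [ZMod.natCast_val, ZMod.intCast_cast, ZMod.cast_id', id_eq, hIco, hp2] at hg
  push_cast at hg
  rw [prod_congr rfl fun (k : ℕ) _ => neg_one_pow_val hn (y * (k : ZMod p)), prod_mul_distrib, hmin,
    prod_pow_eq_pow_sum, hg, prod_ite]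
  simp

theorem two_pow_half (hn : p = 2 * n + 1) :
    (2 : ZMod p) ^ n * (-1) ^ ∑ k ∈ Icc 1 n, k = 1 := by
  rw [← prod_neg_one_pow_val_mul hn (two_ne_zero_of_odd hn)]
  refine prod_eq_one fun k hk => ?_
  rw [mem_Icc] at hk
  have h : (2 * (k : ZMod p)) = ((2 * k : ℕ) : ZMod p) := by push_cast; rfl
  rw [h, ZMod.val_cast_of_lt (by omega)]
  exact (even_two_mul k).neg_one_pow

/-- The integers `{k x} + {k (1 - x)}` and `k` differ by `0` or `p`, and the second case occurs
exactly when `{k x} > k`. -/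
theorem neg_one_pow_val_mul_one_sub (hn : p = 2 * n + 1) (x : ZMod p) {k : ℕ} (hk : k ≤ n) :
    (if k < (k * x).val then (-1 : ZMod p) else 1)
      = (-1) ^ (x * (k : ZMod p)).val * (-1) ^ ((1 - x) * (k : ZMod p)).val * (-1) ^ k := by
  have hkv : (k : ZMod p).val = k := ZMod.val_cast_of_lt (by omega)
  have hlt := ZMod.val_lt (x * (k : ZMod p))
  rw [mul_comm (k : ZMod p) x, ← pow_add, ← pow_add]
  have e1 : (1 - x) * (k : ZMod p) = (k : ZMod p) - x * k := by ring
  rw [e1]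
  split_ifs with h
  · have h2 : ((k : ZMod p) - x * k).val = p + k - (x * (k : ZMod p)).val := by
      have : (k : ZMod p) - x * k = ((p + k - (x * (k : ZMod p)).val : ℕ) : ZMod p) := by
        rw [Nat.cast_sub (by omega)]; simp
      rw [this, ZMod.val_cast_of_lt (by omega)]
    rw [h2, Odd.neg_one_pow ⟨n + k, by omega⟩]
  · rw [ZMod.val_sub (by omega), hkv, Even.neg_one_pow ⟨k, by omega⟩]

theorem neg_one_pow_gaussCount (hn : p = 2 * n + 1) {x : ℤ_[p]}
    (h0 : PadicInt.toZMod x ≠ 0) (h1 : PadicInt.toZMod x ≠ 1) :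
    (-1 : ZMod p) ^ gaussCount p x
      = (2 * PadicInt.toZMod x * (1 - PadicInt.toZMod x)) ^ n := by
  have hval : ∀ y : ℤ_[p], y.zmodRepr = (PadicInt.toZMod y).val := fun y =>
    (PadicInt.val_toZMod_eq_zmodRepr y).symm
  set y := PadicInt.toZMod x with hy
  have hp2 : (p - 1) / 2 = n := by omega
  have key : (-1 : ZMod p) ^ gaussCount p x
      = ∏ k ∈ Icc 1 n, if k < (k * y).val then (-1 : ZMod p) else 1 := by
    rw [prod_ite, prod_const, prod_const_one, mul_one, gaussCount, hp2]
    simp only [hval, map_mul, map_natCast, ← hy]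
  rw [key, prod_congr rfl fun k hk => neg_one_pow_val_mul_one_sub hn y (mem_Icc.1 hk).2,
    prod_mul_distrib, prod_mul_distrib, prod_neg_one_pow_val_mul hn h0,
    prod_neg_one_pow_val_mul hn (sub_ne_zero.2 h1.symm), prod_pow_eq_pow_sum, mul_pow, mul_pow]
  have h2 := two_pow_half hn
  have h3 : (-1 : ZMod p) ^ (∑ k ∈ Icc 1 n, k) * (-1) ^ (∑ k ∈ Icc 1 n, k) = 1 := by
    rw [← mul_pow]; simp
  set e := (-1 : ZMod p) ^ (∑ k ∈ Icc 1 n, k)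
  linear_combination (y ^ n * (1 - y) ^ n * e + 2 ^ n * y ^ n * (1 - y) ^ n) * h3
    - (y ^ n * (1 - y) ^ n * e) * h2

theorem toZMod_padicQuot (a : ℤ) {c : ℤ} (hc : (c : ZMod p) ≠ 0) :
    PadicInt.toZMod (padicQuot p a c) = (a : ZMod p) / c := by
  have h := congrArg PadicInt.toZMod (padicQuot_mul p a c
    (by rwa [← ZMod.intCast_zmod_eq_zero_iff_dvd]))
  rw [map_mul, map_intCast, map_intCast] at h
  rw [eq_div_iff hc, h]

/-- The sign `(-1) ^ N_p(a / c)` as a value of the quadratic character. -/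
theorem neg_one_pow_gaussCount_quot (hn : p = 2 * n + 1) {a c : ℤ} (ha : (a : ZMod p) ≠ 0)
    (hc : (c : ZMod p) ≠ 0) (hac : (a : ZMod p) ≠ c) :
    (-1 : ZMod p) ^ gaussCount p (padicQuot p a c)
      = (2 * (a : ZMod p) * ((c : ZMod p) - a)) ^ n := by
  have h := toZMod_padicQuot a hc
  rw [neg_one_pow_gaussCount hn (by rw [h]; exact div_ne_zero ha hc)
    (by rw [h, ne_eq, div_eq_one_iff_eq hc]; exact hac), h]
  have h2 : (2 * (a : ZMod p) * ((c : ZMod p) - a))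
      = (2 * ((a : ZMod p) / c) * (1 - (a : ZMod p) / c)) * (c * c) := by
    field_simp
  rw [h2, mul_pow _ ((c : ZMod p) * c), mul_pow (c : ZMod p), pow_half_sq hn hc, mul_one]

end GaussCount

/-! ### The box product -/

section Box

variable {p n : ℕ} [Fact p.Prime]

theorem prod_Icc_natCast (hn : p = 2 * n + 1) {M : Type*} [CommMonoid M] (g : ZMod p → M) :
    ∏ k ∈ Icc 1 n, g k = ∏ x ∈ ({x : ZMod p | x ≠ 0 ∧ x.val ≤ n} : Finset (ZMod p)), g x := by
  have hv : ∀ k : ℕ, k ≤ n → (k : ZMod p).val = k := fun k hk =>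
    ZMod.val_cast_of_lt (by omega)
  refine prod_nbij' (fun k => (k : ZMod p)) ZMod.val ?_ ?_ ?_ ?_ fun _ _ => rfl
  · intro k hk
    rw [mem_Icc] at hk
    simp only [mem_filter, mem_univ, true_and, hv k hk.2, hk.2, and_true]
    intro h0
    have := hv k hk.2
    rw [h0, ZMod.val_zero] at this
    omega
  · intro x hx
    simp only [mem_filter, mem_univ, true_and] at hx
    exact mem_Icc.2 ⟨ZMod.val_pos.2 hx.1, hx.2⟩
  · intro k hk
    exact hv k (mem_Icc.1 hk).2
  · intro x _
    exact ZMod.natCast_zmod_val x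

theorem factorial_sq (hn : p = 2 * n + 1) :
    (n.factorial : ZMod p) * n.factorial = -(-1) ^ n := by
  rw [← (isHalfSystem_val_le hn).prod_sq hn, ← prod_Icc_natCast hn (fun x => x ^ 2), prod_pow,
    ← pow_two, ← Finset.prod_Ico_id_eq_factorial]
  push_cast
  rfl

/-- The factor `z` of a product from which the zero factors are left out. -/
def nonzeroFactor (z : ZMod p) : ZMod p := if z = 0 then 1 else z

/-- The number (`0` or `1`) of factors that `z` adds to a product without zero factors. -/
def nonzeroCount (z : ZMod p) : ℕ := if z = 0 then 0 else 1

theorem nonzeroFactor_neg (z : ZMod p) :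
    nonzeroFactor (-z) = (-1) ^ nonzeroCount z * nonzeroFactor z := by
  by_cases hz : z = 0 <;> simp [nonzeroFactor, nonzeroCount, hz]

theorem nonzeroCount_neg (z : ZMod p) : nonzeroCount (-z) = nonzeroCount z := by
  simp [nonzeroCount]

theorem nonzeroCount_mul {u : ZMod p} (hu : u ≠ 0) (z : ZMod p) :
    nonzeroCount (u * z) = nonzeroCount z := by
  simp [nonzeroCount, hu]

theorem IsHalfSystem.prod_nonzeroFactor (hn : p = 2 * n + 1) {S : Finset (ZMod p)}
    (hS : IsHalfSystem S) (z : ZMod p) : ∏ x ∈ S, nonzeroFactor (x ^ 2 * z) = signFactor n z := by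
  by_cases hz : z = 0
  · simp [hz, nonzeroFactor, signFactor_zero]
  · rw [← hS.prod_sq_mul hn hz]
    refine prod_congr rfl fun x hx => if_neg ?_
    exact mul_ne_zero (pow_ne_zero 2 fun h0 => hS.1 (h0 ▸ hx)) hz

@[to_additive]
theorem prod_erase_zero_dilate {M : Type*} [CommMonoid M] {x : ZMod p} (hx : x ≠ 0)
    (g : ZMod p → M) : ∏ y ∈ univ.erase 0, g y = ∏ r ∈ univ.erase 0, g (x * r) := by
  symm
  refine prod_nbij' (fun r => x * r) (fun y => x⁻¹ * y) ?_ ?_ ?_ ?_ fun _ _ => rfl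
  · intro r hr
    simpa [hx] using hr
  · intro r hr
    simpa [hx] using hr
  · intro r _
    simp [hx]
  · intro r _
    simp [hx]

theorem boxProd_cast (hn : p = 2 * n + 1) (a b c : ℤ) :
    (boxProd p n (quadVal a b c) : ZMod p)
      = ∏ x ∈ ({x : ZMod p | x ≠ 0 ∧ x.val ≤ n} : Finset (ZMod p)),
          ∏ y ∈ ({x : ZMod p | x ≠ 0 ∧ x.val ≤ n} : Finset (ZMod p)),
            nonzeroFactor ((a : ZMod p) * x ^ 2 + (b : ZMod p) * x * y + (c : ZMod p) * y ^ 2) := by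
  simp only [← prod_Icc_natCast hn]
  rw [boxProd, prod_filter, prod_product, Int.cast_prod]
  refine prod_congr rfl fun i _ => ?_
  rw [Int.cast_prod]
  refine prod_congr rfl fun j _ => ?_
  simp only [nonzeroFactor, ← ZMod.intCast_zmod_eq_zero_iff_dvd]
  have h : ((quadVal a b c i j : ℤ) : ZMod p)
      = (a : ZMod p) * (i : ZMod p) ^ 2 + (b : ZMod p) * i * j + (c : ZMod p) * (j : ZMod p) ^ 2 := by
    simp [quadVal]
  rw [← h, apply_ite (Int.cast : ℤ → ZMod p), Int.cast_one, ite_not]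

/-- For the form `f = a x² + b x y - a y²` one has `f(y, x) = -f(x, -y)`, so the square of the box
product is, up to a sign that counts factors, the product over all `y ≠ 0` and `x` in a half
system, which is sorted by the ratio `r = y / x`. -/
theorem boxProd_mul_self (hn : p = 2 * n + 1) {a b c : ℤ} (hac : (c : ZMod p) = -a) :
    ∃ M : ℕ, 2 * M = n * ∑ r ∈ univ.erase (0 : ZMod p),
        nonzeroCount ((a : ZMod p) + (b : ZMod p) * r + (c : ZMod p) * r ^ 2) ∧
      (boxProd p n (quadVal a b c) : ZMod p) * (boxProd p n (quadVal a b c) : ZMod p)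
        = (-1) ^ M * ∏ r ∈ univ.erase (0 : ZMod p),
            signFactor n ((a : ZMod p) + (b : ZMod p) * r + (c : ZMod p) * r ^ 2) := by
  have hH := isHalfSystem_val_le hn
  rw [boxProd_cast hn]
  set H := ({x : ZMod p | x ≠ 0 ∧ x.val ≤ n} : Finset (ZMod p))
  set f : ZMod p → ZMod p → ZMod p := fun x y =>
    (a : ZMod p) * x ^ 2 + (b : ZMod p) * x * y + (c : ZMod p) * y ^ 2 with hf
  set h : ZMod p → ZMod p := fun r => (a : ZMod p) + (b : ZMod p) * r + (c : ZMod p) * r ^ 2 with hh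
  change ∃ M : ℕ, 2 * M = n * ∑ r ∈ univ.erase (0 : ZMod p), nonzeroCount (h r) ∧
    (∏ x ∈ H, ∏ y ∈ H, nonzeroFactor (f x y)) * (∏ x ∈ H, ∏ y ∈ H, nonzeroFactor (f x y))
      = (-1) ^ M * ∏ r ∈ univ.erase (0 : ZMod p), signFactor n (h r)
  have hswap : ∀ x y, f y x = -f x (-y) := fun x y => by
    simp only [hf, hac]; ring
  have hratio : ∀ x r, f x (x * r) = x ^ 2 * h r := fun x r => by
    simp only [hf, hh]; ring
  have hne : ∀ x ∈ H, x ≠ 0 := fun x hx h0 => hH.1 (h0 ▸ hx)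
  refine ⟨∑ x ∈ H, ∑ y ∈ H, nonzeroCount (f x (-y)), ?_, ?_⟩
  · have h1 : ∑ x ∈ H, ∑ y ∈ H, nonzeroCount (f x y)
        = ∑ x ∈ H, ∑ y ∈ H, nonzeroCount (f x (-y)) := by
      rw [sum_comm]
      refine sum_congr rfl fun x _ => sum_congr rfl fun y _ => ?_
      rw [hswap, nonzeroCount_neg]
    rw [two_mul]
    nth_rewrite 1 [← h1]
    rw [← sum_add_distrib]
    have h2 : ∀ x ∈ H, (∑ y ∈ H, nonzeroCount (f x y)) + ∑ y ∈ H, nonzeroCount (f x (-y))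
        = ∑ r ∈ univ.erase (0 : ZMod p), nonzeroCount (h r) := by
      intro x hx
      rw [← sum_add_distrib, ← hH.sum_erase_zero (fun y => nonzeroCount (f x y)),
        sum_erase_zero_dilate (hne x hx)]
      simp only [hratio, nonzeroCount_mul (pow_ne_zero 2 (hne x hx))]
    rw [sum_congr rfl h2, sum_const, hH.card_eq hn, smul_eq_mul]
  · have h1 : ∏ x ∈ H, ∏ y ∈ H, nonzeroFactor (f x y)
        = (-1) ^ (∑ x ∈ H, ∑ y ∈ H, nonzeroCount (f x (-y)))
          * ∏ x ∈ H, ∏ y ∈ H, nonzeroFactor (f x (-y)) := by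
      rw [prod_comm, ← prod_pow_eq_pow_sum, ← prod_mul_distrib]
      refine prod_congr rfl fun x _ => ?_
      rw [← prod_pow_eq_pow_sum, ← prod_mul_distrib]
      refine prod_congr rfl fun y _ => ?_
      rw [hswap, nonzeroFactor_neg]
    nth_rewrite 2 [h1]
    rw [mul_left_comm, ← prod_mul_distrib]
    congr 1
    have h2 : ∀ x ∈ H, (∏ y ∈ H, nonzeroFactor (f x y)) * ∏ y ∈ H, nonzeroFactor (f x (-y))
        = ∏ r ∈ univ.erase (0 : ZMod p), nonzeroFactor (x ^ 2 * h r) := by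
      intro x hx
      rw [← prod_mul_distrib, ← hH.prod_erase_zero (fun y => nonzeroFactor (f x y)),
        prod_erase_zero_dilate (hne x hx)]
      simp only [hratio]
    rw [prod_congr rfl h2, prod_comm]
    exact prod_congr rfl fun r _ => hH.prod_nonzeroFactor hn (h r)

theorem sum_nonzeroCount_quadratic (hn : p = 2 * n + 1) {a b c D : ℤ} (ha : (a : ZMod p) ≠ 0)
    (hc : (c : ZMod p) ≠ 0) (hD : D = b ^ 2 - 4 * a * c) :
    ((∑ r ∈ univ.erase (0 : ZMod p),
        nonzeroCount ((a : ZMod p) + (b : ZMod p) * r + (c : ZMod p) * r ^ 2) : ℕ) : ℤ)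
      = 2 * n - 1 - legendreSym p D := by
  have h2 := two_ne_zero_of_odd hn
  have hsum : ∑ r, nonzeroCount ((a : ZMod p) + (b : ZMod p) * r + (c : ZMod p) * r ^ 2)
      = ∑ s : ZMod p, nonzeroCount (s ^ 2 - (D : ZMod p)) := by
    have hbij : Function.Bijective (fun r : ZMod p => 2 * (c : ZMod p) * r + (b : ZMod p)) := by
      apply Function.Injective.bijective_of_finite
      intro x y hxy
      exact mul_left_cancel₀ (mul_ne_zero h2 hc) (add_right_cancel hxy)
    refine Fintype.sum_bijective _ hbij _ _ fun r => ?_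
    have he : (2 * (c : ZMod p) * r + (b : ZMod p)) ^ 2 - (D : ZMod p)
        = (2 * 2 * (c : ZMod p)) * ((a : ZMod p) + (b : ZMod p) * r + (c : ZMod p) * r ^ 2) := by
      rw [hD]; push_cast; ring
    rw [he, nonzeroCount_mul (mul_ne_zero (mul_ne_zero h2 h2) hc)]
  have h0 : nonzeroCount ((a : ZMod p) + (b : ZMod p) * 0 + (c : ZMod p) * 0 ^ 2) = 1 := by
    simp [nonzeroCount, ha]
  have hsplit := add_sum_erase univ
    (fun r => nonzeroCount ((a : ZMod p) + (b : ZMod p) * r + (c : ZMod p) * r ^ 2))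
    (mem_univ (0 : ZMod p))
  simp only [h0, hsum] at hsplit
  have hcount : (∑ s : ZMod p, nonzeroCount (s ^ 2 - (D : ZMod p)))
      + #{s : ZMod p | s ^ 2 = (D : ZMod p)} = p := by
    rw [card_filter, ← sum_add_distrib]
    have : ∀ s : ZMod p, nonzeroCount (s ^ 2 - (D : ZMod p))
        + (if s ^ 2 = (D : ZMod p) then 1 else 0) = 1 := fun s => by
      by_cases hs : s ^ 2 = (D : ZMod p) <;> simp [nonzeroCount, sub_eq_zero, hs]
    simp [this, ZMod.card]
  have hroots := legendreSym.card_sqrts p (by omega) D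
  rw [Set.toFinset_ofPred] at hroots
  omega

theorem pow_half_eq_of_legendreSym (hn : p = 2 * n + 1) {D ε : ℤ} (h : legendreSym p D = ε) :
    (D : ZMod p) ^ n = ε := by
  have := legendreSym.eq_pow p D
  rw [h, show p / 2 = n by omega] at this
  exact this.symm

theorem boxProd_mul_self_of_discr_ne_zero (hn : p = 2 * n + 1) {a b c ε : ℤ}
    (ha : (a : ZMod p) ≠ 0) (hac : (c : ZMod p) = -a) (hε : ε = 1 ∨ ε = -1)
    (hD : legendreSym p (b ^ 2 - 4 * a * c) = ε) :
    (boxProd p n (quadVal a b c) : ZMod p) * (boxProd p n (quadVal a b c) : ZMod p)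
      = if ε = 1 then 1 else -(-1) ^ n := by
  obtain ⟨M, hM, hQ⟩ := boxProd_mul_self (b := b) hn hac
  have hc : (c : ZMod p) ≠ 0 := by rw [hac]; exact neg_ne_zero.2 ha
  have hK := sum_nonzeroCount_quadratic hn (b := b) ha hc rfl
  set K := ∑ r ∈ univ.erase (0 : ZMod p),
        nonzeroCount ((a : ZMod p) + (b : ZMod p) * r + (c : ZMod p) * r ^ 2)
  have hDn := pow_half_eq_of_legendreSym hn hD
  have hD0 : ((b ^ 2 - 4 * a * c : ℤ) : ZMod p) ≠ 0 := fun h => by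
    rw [(legendreSym.eq_zero_iff p _).2 h] at hD
    omega
  have hG := prod_signFactor_quadratic hn (a := (a : ZMod p)) (b := (b : ZMod p)) hc
  rw [← mul_prod_erase univ _ (mem_univ 0)] at hG
  push_cast at hD0 hDn
  rw [if_neg hD0, mul_zero, add_zero, zero_pow two_ne_zero, mul_zero, add_zero] at hG
  have hs := signFactor_mul_self hn (a : ZMod p)
  have hprod : ∏ r ∈ univ.erase (0 : ZMod p),
      signFactor n ((a : ZMod p) + (b : ZMod p) * r + (c : ZMod p) * r ^ 2) = ε := by
    set R := ∏ r ∈ univ.erase (0 : ZMod p),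
      signFactor n ((a : ZMod p) + (b : ZMod p) * r + (c : ZMod p) * r ^ 2)
    have : R = signFactor n (a : ZMod p)
        * -((c : ZMod p) * ((b : ZMod p) ^ 2 - 4 * a * c)) ^ n := by
      linear_combination (-R) * hs + signFactor n (a : ZMod p) * hG
    rw [this, signFactor_of_ne ha, neg_mul_neg, ← hac, mul_pow, hDn, ← mul_assoc,
      pow_half_sq hn hc, one_mul]
  rw [hQ, hprod]
  rw [hD] at hK
  have hnn : Even (n * (n - 1)) := Nat.even_mul_pred_self n
  rcases hε with rfl | rfl
  · have hM' : M = n * (n - 1) := by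
      have h1 : 1 ≤ n := by
        have := (Fact.out : p.Prime).two_le
        omega
      have hK' : K = 2 * (n - 1) := by omega
      rw [hK'] at hM
      linarith
    rw [hM', hnn.neg_one_pow]
    simp
  · have hM' : M = n * n := by
      have hK' : K = 2 * n := by omega
      rw [hK'] at hM
      linarith
    have : (-1 : ZMod p) ^ (n * n) = (-1) ^ n := by
      rcases Nat.even_or_odd n with he | ho
      · rw [he.neg_one_pow, (he.mul_right n).neg_one_pow]
      · rw [ho.neg_one_pow, (ho.mul ho).neg_one_pow]
    rw [hM', this]
    simp

theorem boxProd_mul_self_of_discr_eq_zero (hn : p = 2 * n + 1) {a b c : ℤ}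
    (ha : (a : ZMod p) ≠ 0) (hac : (c : ZMod p) = -a)
    (hD : (p : ℤ) ∣ b ^ 2 - 4 * a * c) :
    Even n ∧ (boxProd p n (quadVal a b c) : ZMod p) * (boxProd p n (quadVal a b c) : ZMod p)
      = -(2 * (b : ZMod p)) ^ n := by
  obtain ⟨M, hM, hQ⟩ := boxProd_mul_self (b := b) hn hac
  have hc : (c : ZMod p) ≠ 0 := by rw [hac]; exact neg_ne_zero.2 ha
  have hK := sum_nonzeroCount_quadratic hn (b := b) ha hc rfl
  set K := ∑ r ∈ univ.erase (0 : ZMod p),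
        nonzeroCount ((a : ZMod p) + (b : ZMod p) * r + (c : ZMod p) * r ^ 2)
  have hD0 := (ZMod.intCast_zmod_eq_zero_iff_dvd _ _).2 hD
  rw [(legendreSym.eq_zero_iff p _).2 hD0] at hK
  push_cast at hD0
  have hG := prod_signFactor_quadratic hn (a := (a : ZMod p)) (b := (b : ZMod p)) hc
  rw [← mul_prod_erase univ _ (mem_univ 0)] at hG
  rw [if_pos hD0, mul_zero, add_zero, zero_pow two_ne_zero, mul_zero, add_zero] at hG
  have h2 := two_ne_zero_of_odd hn
  have hb2 : (b : ZMod p) ^ 2 = -(2 * a) ^ 2 := by rw [hac] at hD0; linear_combination hD0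
  have hb : (b : ZMod p) ≠ 0 := fun h0 => by
    rw [h0, zero_pow two_ne_zero, eq_comm, neg_eq_zero] at hb2
    exact pow_ne_zero 2 (mul_ne_zero h2 ha) hb2
  have h2a := pow_half_sq hn (mul_ne_zero h2 ha)
  -- `-1` is a square, namely that of `b / 2a`, so `n` is even.
  have hne : Even n := by
    by_contra ho
    rw [Nat.not_even_iff_odd] at ho
    have h1 := congrArg (· ^ n) hb2
    simp only [ho.neg_pow, ← pow_mul, mul_comm 2 n] at h1
    rw [mul_two, pow_add, pow_add, pow_half_sq hn hb, h2a] at h1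
    exact neg_ne_self_of_ne_zero hn one_ne_zero h1.symm
  refine ⟨hne, ?_⟩
  obtain ⟨m, hm⟩ := hne
  have hM' : (-1 : ZMod p) ^ M = (-1) ^ m := by
    have hK' : K + 1 = 2 * n := by omega
    have hMm : M + m = m * (2 * n) := by
      rw [← hK']
      have : 2 * M = 2 * (m * K) := by rw [hM]; nth_rewrite 1 [hm]; ring
      linarith
    have h1 : (-1 : ZMod p) ^ (M + m) = 1 := by
      rw [hMm]; exact Even.neg_one_pow ⟨m * n, by ring⟩
    have h3 : (-1 : ZMod p) ^ m * (-1) ^ m = 1 := by rw [← mul_pow]; simp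
    rw [pow_add] at h1
    linear_combination (-1 : ZMod p) ^ m * h1 - (-1 : ZMod p) ^ M * h3
  have h2b : (2 * (b : ZMod p)) ^ n = (-1) ^ m * (a : ZMod p) ^ n := by
    have h4 : (2 * (b : ZMod p)) ^ n = (-1) ^ m * ((2 * 2) ^ n * (a : ZMod p) ^ n) := by
      rw [hm, ← two_mul, pow_mul, mul_pow, hb2, pow_mul _ 2 m, pow_mul _ 2 m, ← mul_pow,
        ← mul_pow]
      congr 1
      ring
    rw [h4, mul_pow 2 2 n, pow_half_sq hn h2, one_mul]
  have hs : signFactor n (a : ZMod p) = -(a : ZMod p) ^ n := by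
    rw [signFactor_of_ne ha, Even.neg_pow ⟨m, hm⟩]
  have ha2 := pow_half_sq hn ha
  rw [hs] at hG
  rw [hQ, hM', h2b]
  linear_combination (-(-1 : ZMod p) ^ m * (a : ZMod p) ^ n) * hG
    - ((-1 : ZMod p) ^ m * ∏ r ∈ univ.erase (0 : ZMod p),
      signFactor n ((a : ZMod p) + (b : ZMod p) * r + (c : ZMod p) * r ^ 2)) * ha2

end Box

/-! ### The product of the sums of two squares -/

section SumTwoSquares

variable {p n : ℕ} [Fact p.Prime]

theorem exists_isPrimitiveRoot_half (hn : p = 2 * n + 1) : ∃ ζ : ZMod p, IsPrimitiveRoot ζ n := by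
  obtain ⟨g, hg⟩ := IsCyclic.exists_ofOrder_eq_natCard (α := (ZMod p)ˣ)
  have h := IsPrimitiveRoot.coe_units_iff.2 (IsPrimitiveRoot.orderOf g)
  rw [hg, Nat.card_eq_fintype_card, ZMod.card_units, show p - 1 = 2 * n by omega] at h
  have h2 := (Fact.out : p.Prime).two_le
  exact ⟨_, h.pow (by omega) rfl⟩

/-- Every `n`-th root of unity is the square of one of `1, …, n`. -/
theorem exists_sq_eq_of_pow_half (hn : p = 2 * n + 1) {u : ZMod p} (hu : u ^ n = 1) :
    ∃ i : ℕ, i ∈ Icc 1 n ∧ (i : ZMod p) ^ 2 = u := by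
  have hu0 : u ≠ 0 := by
    rintro rfl
    have := (Fact.out : p.Prime).two_le
    rw [zero_pow (by omega)] at hu
    exact zero_ne_one hu
  obtain ⟨y, rfl⟩ := (ZMod.euler_criterion p hu0).2 (by rwa [show p / 2 = n by omega])
  have hy : y ≠ 0 := left_ne_zero_of_mul hu0
  refine ⟨y.valMinAbs.natAbs, mem_Icc.2 ⟨?_, ?_⟩, ?_⟩
  · simpa [Nat.one_le_iff_ne_zero] using hy
  · have := ZMod.natAbs_valMinAbs_le y
    omega
  · rw [ZMod.natCast_natAbs_valMinAbs]
    split_ifs <;> ring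

theorem natCast_ne_zero_of_mem_Icc (hn : p = 2 * n + 1) {i : ℕ} (hi : i ∈ Icc 1 n) :
    (i : ZMod p) ≠ 0 := by
  rw [mem_Icc] at hi
  rw [ne_eq, ZMod.natCast_eq_zero_iff]
  exact Nat.not_dvd_of_pos_of_lt hi.1 (by omega)

theorem natCast_sq_injOn (hn : p = 2 * n + 1) {i j : ℕ} (hi : i ∈ Icc 1 n) (hj : j ∈ Icc 1 n)
    (h : (i : ZMod p) ^ 2 = (j : ZMod p) ^ 2) : i = j := by
  rw [mem_Icc] at hi hj
  rcases sq_eq_sq_iff_eq_or_eq_neg.1 h with h | h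
  · have h1 := congrArg ZMod.val h
    rwa [ZMod.val_cast_of_lt (by omega), ZMod.val_cast_of_lt (by omega)] at h1
  · have h1 : ((i + j : ℕ) : ZMod p) = 0 := by push_cast; rw [h]; ring
    rw [ZMod.natCast_eq_zero_iff] at h1
    exact absurd h1 (Nat.not_dvd_of_pos_of_lt (by omega) (by omega))

/-- The factor of an unordered pair `{i, j}` in the product of the nonzero `i² + j²`. -/
def sumSqFactor (p : ℕ) [Fact p.Prime] : Sym2 ℕ → ZMod p :=
  Sym2.lift ⟨fun i j => nonzeroFactor ((i : ZMod p) ^ 2 + (j : ZMod p) ^ 2), fun _ _ =>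
    congrArg nonzeroFactor (add_comm _ _)⟩

/-- A symmetric function of `i` and `j` may be multiplied over the unordered pairs. -/
theorem triProd_cast_sum_sq {m : ℕ} :
    (triProd p m (fun i j => (i : ℤ) ^ 2 + (j : ℤ) ^ 2) : ZMod p)
      = ∏ e ∈ (Icc 1 m).sym2 with ¬ e.IsDiag, sumSqFactor p e := by
  refine Eq.trans ?_ (sum_sym2_filter_not_isDiag (M := Additive (ZMod p)) (Icc 1 m)
    (sumSqFactor p)).symm
  change _ = ∏ x ∈ (Icc 1 m).offDiag with x.1 < x.2,
    nonzeroFactor ((x.1 : ZMod p) ^ 2 + (x.2 : ZMod p) ^ 2)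
  rw [triProd, Int.cast_prod, ← filter_filter, prod_filter]
  refine prod_congr ?_ fun x _ => ?_
  · ext x
    simp only [mem_filter, mem_product, mem_offDiag]
    constructor
    · rintro ⟨⟨h1, h2⟩, h3⟩
      exact ⟨⟨h1, h2, h3.ne⟩, h3⟩
    · rintro ⟨⟨h1, h2, _⟩, h3⟩
      exact ⟨⟨h1, h2⟩, h3⟩
  · simp only [← ZMod.intCast_zmod_eq_zero_iff_dvd, ite_not, nonzeroFactor]
    push_cast
    rfl

/-- If `-1` is a square, the unordered pairs of distinct nonzero squares with nonzero sum are the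
`{u, u ζ ^ k}` with `1 ≤ k < n / 2`, where `ζ` generates the group of squares; here `u = i²`. -/
theorem triProd_cast_sum_sq_eq_prod {l : ℕ} (hn : p = 2 * n + 1) (hl : n = 2 * (l + 1))
    {ζ : ZMod p} (hζ : IsPrimitiveRoot ζ n) (hm : ζ ^ (l + 1) = -1) :
    (triProd p n (fun i j => (i : ℤ) ^ 2 + (j : ℤ) ^ 2) : ZMod p)
      = ∏ k ∈ range l, ∏ i ∈ Icc 1 n, ((i : ZMod p) ^ 2 * (1 + ζ ^ (k + 1))) := by
  have hroot : ∀ u : ZMod p, ∃ i : ℕ, u ^ n = 1 → i ∈ Icc 1 n ∧ (i : ZMod p) ^ 2 = u := fun u => by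
    by_cases hu : u ^ n = 1
    · obtain ⟨i, hi⟩ := exists_sq_eq_of_pow_half hn hu
      exact ⟨i, fun _ => hi⟩
    · exact ⟨0, fun h => absurd h hu⟩
  choose rt hrt using hroot
  have hpow : ∀ i ∈ Icc 1 n, ∀ k, ((i : ZMod p) ^ 2 * ζ ^ k) ^ n = 1 := fun i hi k => by
    rw [mul_pow, ← pow_mul, mul_comm 2, pow_mul, pow_two,
      pow_half_sq hn (natCast_ne_zero_of_mem_Icc hn hi), ← pow_mul, mul_comm k, pow_mul,
      hζ.pow_eq_one, one_pow, one_mul]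
  have hne : ∀ k, k < l → (1 + ζ ^ (k + 1)) ≠ 0 := fun k hk h0 => by
    have h1 : ζ ^ (k + 1) = ζ ^ (l + 1) := by rw [hm]; linear_combination h0
    have := hζ.pow_inj (by omega) (by omega) h1
    omega
  have hζ0 : ζ ≠ 0 := hζ.ne_zero (by omega)
  rw [triProd_cast_sum_sq, ← prod_product_right']
  symm
  refine prod_of_injOn (fun x => s(x.1, rt ((x.1 : ZMod p) ^ 2 * ζ ^ (x.2 + 1)))) ?_ ?_ ?_ ?_
  · rintro ⟨i, k⟩ hx ⟨i', k'⟩ hx' h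
    simp only [coe_product, Set.mem_prod, mem_coe, mem_range] at hx hx'
    obtain ⟨hj, hjr⟩ := hrt _ (hpow i hx.1 (k + 1))
    obtain ⟨hj', hjr'⟩ := hrt _ (hpow i' hx'.1 (k' + 1))
    have hi0 := pow_ne_zero 2 (natCast_ne_zero_of_mem_Icc hn hx.1)
    rcases Sym2.eq_iff.1 h with ⟨h1, h2⟩ | ⟨h1, h2⟩
    · dsimp only at h1 h2
      subst h1
      have h3 : (i : ZMod p) ^ 2 * ζ ^ (k + 1) = (i : ZMod p) ^ 2 * ζ ^ (k' + 1) := by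
        rw [← hjr, ← hjr', h2]
      have := hζ.pow_inj (by omega) (by omega) (mul_left_cancel₀ hi0 h3)
      simp only [Prod.mk.injEq, true_and]
      omega
    · -- The ratios would be inverse to each other, which the range of `k` excludes.
      dsimp only at h1 h2
      rw [← h1] at hjr'
      rw [h2] at hjr
      have h3 : (i : ZMod p) ^ 2 * ζ ^ (k + 1 + (k' + 1)) = (i : ZMod p) ^ 2 * 1 := by
        rw [pow_add, ← mul_assoc, ← hjr, mul_one, hjr']
      exact absurd (mul_left_cancel₀ hi0 h3) (hζ.pow_ne_one_of_pos_of_lt (by omega) (by omega))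
  · rintro ⟨i, k⟩ hx
    simp only [coe_product, Set.mem_prod, mem_coe, mem_range] at hx
    obtain ⟨hj, hjr⟩ := hrt _ (hpow i hx.1 (k + 1))
    have hi0 := pow_ne_zero 2 (natCast_ne_zero_of_mem_Icc hn hx.1)
    simp only [coe_filter, mem_sym2_iff, Set.mem_ofPred_eq, Sym2.mem_iff, Sym2.mk_isDiag_iff]
    refine ⟨?_, fun h => ?_⟩
    · rintro a (rfl | rfl)
      · exact hx.1
      · exact hj
    · rw [← h] at hjr
      have h3 : (i : ZMod p) ^ 2 * ζ ^ (k + 1) = (i : ZMod p) ^ 2 * 1 := by rw [← hjr, mul_one]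
      exact absurd (mul_left_cancel₀ hi0 h3) (hζ.pow_ne_one_of_pos_of_lt (by omega) (by omega))
  · intro e
    induction e with | _ i j
    intro he hnot
    simp only [mem_filter, mem_sym2_iff, Sym2.mem_iff, Sym2.mk_isDiag_iff] at he
    obtain ⟨hmem, hij⟩ := he
    have hi := hmem i (Or.inl rfl)
    have hj := hmem j (Or.inr rfl)
    have hi0 := pow_ne_zero 2 (natCast_ne_zero_of_mem_Icc hn hi)
    have hj0 := pow_ne_zero 2 (natCast_ne_zero_of_mem_Icc hn hj)
    have hpi := hpow i hi 0
    have hpj := hpow j hj 0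
    rw [pow_zero, mul_one] at hpi hpj
    have hrti : ∀ i ∈ Icc 1 n, ((i : ZMod p) ^ 2) ^ n = 1 → rt ((i : ZMod p) ^ 2) = i :=
      fun i hi h => natCast_sq_injOn hn (hrt _ h).1 hi (hrt _ h).2
    have : NeZero n := ⟨by omega⟩
    obtain ⟨k, hk, hkr⟩ := hζ.eq_pow_of_pow_eq_one
      (ξ := (j : ZMod p) ^ 2 / (i : ZMod p) ^ 2) (by rw [div_pow, hpi, hpj, div_one])
    rw [eq_div_iff hi0] at hkr
    change nonzeroFactor ((i : ZMod p) ^ 2 + (j : ZMod p) ^ 2) = 1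
    refine if_pos ?_
    by_contra hne0
    apply hnot
    have hk0 : k ≠ 0 := fun h0 => hij (natCast_sq_injOn hn hi hj (by rw [← hkr, h0]; simp))
    have hkl : k ≠ l + 1 := fun h0 => hne0 (by rw [← hkr, h0, hm]; ring)
    rcases lt_or_gt_of_ne hkl with h | h
    · refine ⟨(i, k - 1), ?_, ?_⟩
      · simp only [coe_product, Set.mem_prod, mem_coe, mem_range, hi, true_and]
        omega
      · dsimp only
        rw [show k - 1 + 1 = k by omega, mul_comm, hkr, hrti j hj hpj]
    · refine ⟨(j, n - k - 1), ?_, ?_⟩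
      · simp only [coe_product, Set.mem_prod, mem_coe, mem_range, hj, true_and]
        omega
      · dsimp only
        have h3 : (j : ZMod p) ^ 2 * ζ ^ (n - k) = (i : ZMod p) ^ 2 := by
          rw [← hkr, mul_right_comm, ← pow_add, show k + (n - k) = n by omega, hζ.pow_eq_one,
            one_mul]
        rw [show n - k - 1 + 1 = n - k by omega, h3, hrti i hi hpi, Sym2.eq_swap]
  · rintro ⟨i, k⟩ hx
    simp only [mem_product, mem_range] at hx
    obtain ⟨hj, hjr⟩ := hrt _ (hpow i hx.1 (k + 1))
    have hi0 := pow_ne_zero 2 (natCast_ne_zero_of_mem_Icc hn hx.1)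
    change _ = nonzeroFactor ((i : ZMod p) ^ 2
      + (rt ((i : ZMod p) ^ 2 * ζ ^ (k + 1)) : ZMod p) ^ 2)
    have h3 : (i : ZMod p) ^ 2 + (i : ZMod p) ^ 2 * ζ ^ (k + 1)
        = (i : ZMod p) ^ 2 * (1 + ζ ^ (k + 1)) := by ring
    rw [hjr, h3, nonzeroFactor, if_neg (mul_ne_zero hi0 (hne k hx.2))]

/-- In `∏_{0 < k < 2 (l + 1)} (1 - ζ ^ k) = 2 (l + 1)` the factors on both sides of the middle one,
which is `2`, are `1 + ζ ^ k` and `1 + ζ ^ (-k)`. -/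
theorem prod_one_add_pow_sq {l : ℕ} {ζ : ZMod p} (h2 : (2 : ZMod p) ≠ 0)
    (hζ : IsPrimitiveRoot ζ (2 * (l + 1))) (hm : ζ ^ (l + 1) = -1) :
    (∏ k ∈ range l, (1 + ζ ^ (k + 1))) ^ 2 = (l + 1) * ζ ^ ∑ k ∈ range l, (k + 1) := by
  have h := hζ.prod_one_sub_pow_eq_order
  rw [show Nat.mul 2 l + 1 = l + 1 + l by rw [Nat.mul_eq]; ring, prod_range_add,
    prod_range_succ, hm] at h
  have h3 : ∏ k ∈ range l, (1 - ζ ^ (l + 1 + k + 1)) = ∏ k ∈ range l, (1 + ζ ^ (k + 1)) := by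
    refine prod_congr rfl fun k _ => ?_
    rw [add_assoc (l + 1), pow_add, hm]
    ring
  have h1 : (∏ k ∈ range l, (1 - ζ ^ (k + 1))) * ζ ^ ∑ k ∈ range l, (k + 1)
      = ∏ k ∈ range l, (1 + ζ ^ (k + 1)) := by
    rw [← prod_range_reflect, ← prod_pow_eq_pow_sum, ← prod_mul_distrib]
    refine prod_congr rfl fun k hk => ?_
    rw [mem_range] at hk
    rw [sub_mul, one_mul, ← pow_add, show l - 1 - k + 1 + (k + 1) = l + 1 by omega, hm]
    ring
  rw [h3] at h
  push_cast at h
  refine mul_left_cancel₀ h2 ?_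
  set B := ∏ k ∈ range l, (1 + ζ ^ (k + 1))
  set A := ∏ k ∈ range l, (1 - ζ ^ (k + 1))
  set Z := ζ ^ ∑ k ∈ range l, (k + 1)
  linear_combination Z * h - (2 * B) * h1

theorem triProd_sum_sq (hp : p % 4 = 1) :
    (triProd p ((p - 1) / 2) (fun i j => (i : ℤ) ^ 2 + (j : ℤ) ^ 2) : ZMod p)
      = (-1) ^ ((p - 5) / 8) := by
  obtain ⟨l, hl⟩ : ∃ l, p = 4 * (l + 1) + 1 := ⟨p / 4 - 1, by
    have := (Fact.out : p.Prime).two_le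
    omega⟩
  obtain ⟨n, hnl⟩ : ∃ n, n = 2 * (l + 1) := ⟨_, rfl⟩
  have hn : p = 2 * n + 1 := by omega
  have h2 := two_ne_zero_of_odd hn
  obtain ⟨ζ, hζ⟩ := exists_isPrimitiveRoot_half hn
  have hm : ζ ^ (l + 1) = -1 := by
    have h1 : (ζ ^ (l + 1)) ^ 2 = 1 := by
      rw [← pow_mul, mul_comm, ← hnl, hζ.pow_eq_one]
    rcases sq_eq_sq_iff_eq_or_eq_neg.1 (h1.trans (one_pow 2).symm) with h | h
    · exact absurd h (hζ.pow_ne_one_of_pos_of_lt (by omega) (by omega))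
    · exact h
  have hne : ∀ k, k < l → (1 + ζ ^ (k + 1)) ≠ 0 := fun k hk h0 => by
    have h1 : ζ ^ (k + 1) = ζ ^ (l + 1) := by rw [hm]; linear_combination h0
    have := hζ.pow_inj (by omega) (by omega) h1
    omega
  have hneven : Even n := ⟨l + 1, by omega⟩
  rw [show (p - 1) / 2 = n by omega, triProd_cast_sum_sq_eq_prod hn hnl hζ hm]
  have h3 : ∀ k ∈ range l, ∏ i ∈ Icc 1 n, ((i : ZMod p) ^ 2 * (1 + ζ ^ (k + 1)))
      = (-1) * (1 + ζ ^ (k + 1)) ^ n := by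
    intro k hk
    rw [prod_Icc_natCast hn (fun x => x ^ 2 * (1 + ζ ^ (k + 1))),
      (isHalfSystem_val_le hn).prod_sq_mul hn (hne k (mem_range.1 hk)),
      signFactor_of_ne (hne k (mem_range.1 hk)), hneven.neg_pow, neg_one_mul]
  have hB := prod_one_add_pow_sq h2 (hnl ▸ hζ) hm
  -- `l + 1 = -1/4` in `ZMod p`, and its power `l + 1` is the sign of `2` times `(-1) ^ (l + 1)`.
  have hquarter : ((l : ZMod p) + 1) ^ (l + 1) = 1 := by
    have h4 : (2 ^ 2 : ZMod p) * ((l : ZMod p) + 1) = -1 := by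
      have h5 : ((4 * (l + 1) + 1 : ℕ) : ZMod p) = 0 := by rw [← hl, ZMod.natCast_self]
      push_cast at h5
      linear_combination h5
    have h6 := two_pow_half hn
    have h7 : (-1 : ZMod p) ^ ∑ k ∈ Icc 1 n, k = (-1) ^ (l + 1) := by
      have h8 : (∑ k ∈ Icc 1 n, k) * 2 = (n + 1) * n := by
        have h9 := Finset.sum_range_id_mul_two (n + 1)
        rw [Finset.range_eq_Ico, Finset.sum_eq_sum_Ico_succ_bot (by omega)] at h9
        rw [zero_add, zero_add, Nat.add_sub_cancel] at h9
        exact h9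
      have h10 : (∑ k ∈ Icc 1 n, k) = (l + 1) + 2 * (l + 1) ^ 2 := by
        rw [hnl] at h8 ⊢
        nlinarith
      rw [h10, pow_add, pow_mul]
      simp
    have h11 := congrArg (· ^ (l + 1)) h4
    simp only [mul_pow] at h11
    rw [← pow_mul, ← hnl] at h11
    rw [h7, ← h11, ← mul_assoc, pow_half_sq hn h2, one_mul] at h6
    exact h6
  have hsum : (∑ k ∈ range l, (k + 1)) * 2 = (l + 1) * l := by
    have h9 := Finset.sum_range_id_mul_two (l + 1)
    rw [Finset.sum_range_succ'] at h9
    simpa using h9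
  rw [prod_congr rfl h3, prod_mul_distrib, prod_pow, prod_const, card_range]
  rw [show (∏ k ∈ range l, (1 + ζ ^ (k + 1))) ^ n
      = ((∏ k ∈ range l, (1 + ζ ^ (k + 1))) ^ 2) ^ (l + 1) by rw [← pow_mul, ← hnl],
    hB, mul_pow, hquarter, one_mul, ← pow_mul, mul_comm _ (l + 1), pow_mul, hm, ← pow_add, show (p - 5) / 8 = l / 2 by omega]
  apply neg_one_pow_congr
  rcases Nat.even_or_odd' l with ⟨t, rfl | rfl⟩
  · have h12 : ∑ k ∈ range (2 * t), (k + 1) = (2 * t + 1) * t := by nlinarith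
    rw [h12, show 2 * t / 2 = t by omega]
    simp [parity_simps]
  · have h12 : ∑ k ∈ range (2 * t + 1), (k + 1) = (t + 1) * (2 * t + 1) := by nlinarith
    rw [h12, show (2 * t + 1) / 2 = t by omega]
    simp [parity_simps]

end SumTwoSquares

/-! ### Quadratic characters of the coefficients -/

section Evaluation

variable {p n : ℕ} [Fact p.Prime]

theorem intModEq_iff_cast {x y : ℤ} : x ≡ y [ZMOD p] ↔ (x : ZMod p) = (y : ZMod p) :=
  (ZMod.intCast_eq_intCast_iff x y p).symm

theorem legendreSym_cast (hn : p = 2 * n + 1) (a : ℤ) :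
    (legendreSym p a : ZMod p) = (a : ZMod p) ^ n := by
  rw [legendreSym.eq_pow, show p / 2 = n by omega]

theorem triProd_cast_of_discr_eq_zero (hn : p = 2 * n + 1) {a b c : ℤ} (hc : (c : ZMod p) ≠ 0)
    (hD : (b : ZMod p) ^ 2 - 4 * a * c = 0) :
    (triProd p (p - 1) (quadVal a b c) : ZMod p)
      = signFactor n (a : ZMod p) * signFactor n ((a : ZMod p) + (b : ZMod p) + (c : ZMod p)) := by
  rw [triProd_cast hn, prod_signFactor_quadratic hn hc, if_pos hD, one_mul]

theorem triProd_cast_of_discr_ne_zero (hn : p = 2 * n + 1) {a b c : ℤ} (hc : (c : ZMod p) ≠ 0)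
    (hD : (b : ZMod p) ^ 2 - 4 * a * c ≠ 0) :
    (triProd p (p - 1) (quadVal a b c) : ZMod p)
      = -((c : ZMod p) * ((b : ZMod p) ^ 2 - 4 * a * c)) ^ n * signFactor n (a : ZMod p)
        * signFactor n ((a : ZMod p) + (b : ZMod p) + (c : ZMod p)) := by
  rw [triProd_cast hn, prod_signFactor_quadratic hn hc, if_neg hD]

theorem triProd_cast_linear (hn : p = 2 * n + 1) {a b c : ℤ} (hc : (c : ZMod p) = 0)
    (hb : (b : ZMod p) ≠ 0) :
    (triProd p (p - 1) (quadVal a b c) : ZMod p)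
      = (-1) ^ n * signFactor n (a : ZMod p)
        * signFactor n ((a : ZMod p) + (b : ZMod p)) := by
  rw [triProd_cast hn]
  simp only [hc, zero_mul, add_zero, prod_signFactor_linear hn hb]

theorem triProd_cast_const (hn : p = 2 * n + 1) {a b c : ℤ} (hc : (c : ZMod p) = 0)
    (hb : (b : ZMod p) = 0) :
    (triProd p (p - 1) (quadVal a b c) : ZMod p) = signFactor n (a : ZMod p) := by
  rw [triProd_cast hn]
  simp only [hc, hb, zero_mul, add_zero, prod_signFactor_const]
  rw [signFactor_mul_self hn, one_mul]

/-- Two residues with the same square are equal up to sign. -/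
theorem intModEq_or_neg_of_mul_self {x y : ℤ}
    (h : (x : ZMod p) * (x : ZMod p) = (y : ZMod p) * (y : ZMod p)) :
    x ≡ y [ZMOD p] ∨ x ≡ -y [ZMOD p] := by
  rw [intModEq_iff_cast, intModEq_iff_cast, Int.cast_neg]
  exact mul_self_eq_mul_self_iff.1 h

theorem boxProd_of_legendreSym (hn : p = 2 * n + 1) {a b c : ℤ} (ha : (a : ZMod p) ≠ 0)
    (hac : (c : ZMod p) = -a) :
    ((legendreSym p (b ^ 2 - 4 * a * c) = -1 ∨
        ((p : ℤ) ∣ b ^ 2 - 4 * a * c ∧ legendreSym p (2 * b) = 1)) →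
      (boxProd p n (quadVal a b c) ≡ (Nat.factorial n : ℤ) [ZMOD p] ∨
        boxProd p n (quadVal a b c) ≡ -(Nat.factorial n : ℤ) [ZMOD p])) ∧
    ((legendreSym p (b ^ 2 - 4 * a * c) = 1 ∨
        ((p : ℤ) ∣ b ^ 2 - 4 * a * c ∧ legendreSym p (2 * b) = -1)) →
      (boxProd p n (quadVal a b c) ≡ 1 [ZMOD p] ∨
        boxProd p n (quadVal a b c) ≡ -1 [ZMOD p])) := by
  refine ⟨fun h => intModEq_or_neg_of_mul_self ?_, fun h => intModEq_or_neg_of_mul_self ?_⟩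
  · rw [Int.cast_natCast, factorial_sq hn]
    rcases h with h | ⟨hD, hb⟩
    · rw [boxProd_mul_self_of_discr_ne_zero hn ha hac (Or.inr rfl) h, if_neg (by norm_num)]
    · obtain ⟨hne, hQ⟩ := boxProd_mul_self_of_discr_eq_zero hn ha hac hD
      have h2b := pow_half_eq_of_legendreSym hn hb
      push_cast at h2b
      rw [hQ, h2b, hne.neg_one_pow]
  · rw [Int.cast_one, one_mul]
    rcases h with h | ⟨hD, hb⟩
    · rw [boxProd_mul_self_of_discr_ne_zero hn ha hac (Or.inl rfl) h, if_pos rfl]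
    · obtain ⟨hne, hQ⟩ := boxProd_mul_self_of_discr_eq_zero hn ha hac hD
      have h2b := pow_half_eq_of_legendreSym hn hb
      push_cast at h2b
      rw [hQ, h2b, neg_neg]

end Evaluation

theorem theorem1p2 (p : ℕ) [Fact p.Prime] (hp : p ≠ 2) :
    -- (i)
    (p % 4 = 1 →
      triProd p ((p - 1) / 2) (fun i j => (i : ℤ) ^ 2 + (j : ℤ) ^ 2)
        ≡ (-1) ^ ((p - 5) / 8) [ZMOD p]) ∧
    -- (ii), first part
    (∀ a b c : ℤ, ¬ (p : ℤ) ∣ a * c * (a + b + c) →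
      ((p : ℤ) ∣ b ^ 2 - 4 * a * c →
        triProd p (p - 1) (quadVal a b c) ≡ legendreSym p (a * (a + b + c)) [ZMOD p]) ∧
      (¬ (p : ℤ) ∣ b ^ 2 - 4 * a * c →
        triProd p (p - 1) (quadVal a b c)
          ≡ -legendreSym p (a * c * (a + b + c) * (b ^ 2 - 4 * a * c)) [ZMOD p])) ∧
    -- (ii), second part
    (∀ a b c : ℤ, ¬ (p : ℤ) ∣ a * c * (a + b + c) → a + c = 0 →
      ((legendreSym p (b ^ 2 - 4 * a * c) = -1 ∨
          ((p : ℤ) ∣ b ^ 2 - 4 * a * c ∧ legendreSym p (2 * b) = 1)) →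
        (boxProd p ((p - 1) / 2) (quadVal a b c)
            ≡ (Nat.factorial ((p - 1) / 2) : ℤ) [ZMOD p] ∨
          boxProd p ((p - 1) / 2) (quadVal a b c)
            ≡ -(Nat.factorial ((p - 1) / 2) : ℤ) [ZMOD p])) ∧
      ((legendreSym p (b ^ 2 - 4 * a * c) = 1 ∨
          ((p : ℤ) ∣ b ^ 2 - 4 * a * c ∧ legendreSym p (2 * b) = -1)) →
        (boxProd p ((p - 1) / 2) (quadVal a b c) ≡ 1 [ZMOD p] ∨
          boxProd p ((p - 1) / 2) (quadVal a b c) ≡ -1 [ZMOD p]))) ∧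
    -- (iii)
    (∀ a b c : ℤ, ¬ (p : ℤ) ∣ a * c → (p : ℤ) ∣ a + b + c →
      (¬ (p : ℤ) ∣ a - c →
        triProd p (p - 1) (quadVal a b c)
          ≡ (-1) ^ gaussCount p (padicQuot p a c) * legendreSym p (2 * c * (a - c)) [ZMOD p]) ∧
      ((p : ℤ) ∣ a - c →
        triProd p (p - 1) (quadVal a b c)
          ≡ (-1) ^ ((p + 1) / 2) * legendreSym p a [ZMOD p])) ∧
    -- (iv)
    (∀ a b c : ℤ, (p : ℤ) ∣ a * c →
      ((p : ℤ) ∣ a → ¬ (p : ℤ) ∣ b → (p : ℤ) ∣ c →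
        triProd p (p - 1) (quadVal a b c) ≡ -legendreSym p b [ZMOD p]) ∧
      ((p : ℤ) ∣ a → ¬ (p : ℤ) ∣ b * c → (p : ℤ) ∣ b + c →
        triProd p (p - 1) (quadVal a b c) ≡ -legendreSym p c [ZMOD p]) ∧
      ((p : ℤ) ∣ a → ¬ (p : ℤ) ∣ b * c * (b + c) →
        triProd p (p - 1) (quadVal a b c)
          ≡ (-1) ^ gaussCount p (padicQuot p (-c) b) * legendreSym p 2 [ZMOD p]) ∧
      ((p : ℤ) ∣ a → (p : ℤ) ∣ b → ¬ (p : ℤ) ∣ c →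
        triProd p (p - 1) (quadVal a b c)
          ≡ (-1) ^ ((p + 1) / 2) * legendreSym p c [ZMOD p]) ∧
      (¬ (p : ℤ) ∣ a → (p : ℤ) ∣ b → (p : ℤ) ∣ c →
        triProd p (p - 1) (quadVal a b c)
          ≡ (-1) ^ ((p + 1) / 2) * legendreSym p a [ZMOD p]) ∧
      (¬ (p : ℤ) ∣ a * b → (p : ℤ) ∣ a + b → (p : ℤ) ∣ c →
        triProd p (p - 1) (quadVal a b c)
          ≡ (-1) ^ ((p + 1) / 2) * legendreSym p b [ZMOD p]) ∧
      (¬ (p : ℤ) ∣ a * b * (a + b) → (p : ℤ) ∣ c →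
        triProd p (p - 1) (quadVal a b c)
          ≡ (-1) ^ gaussCount p (padicQuot p (-a) b) * legendreSym p 2 [ZMOD p])) := by

  obtain ⟨n, hn⟩ : ∃ n, p = 2 * n + 1 := (Fact.out : p.Prime).odd_of_ne_two hp
  have hhalf : (p - 1) / 2 = n := by omega
  have hhalf' : (p + 1) / 2 = n + 1 := by omega
  have h2 := two_ne_zero_of_odd hn
  have hone : ((-1 : ZMod p) ^ n) * (-1) ^ n = 1 := by rw [← mul_pow]; simp
  have htwo : ((2 : ZMod p) ^ n) * 2 ^ n = 1 := pow_half_sq hn h2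
  refine ⟨fun h4 => ?_, fun a b c h => ?_, fun a b c h hac => ?_, fun a b c hac hs => ?_,
    fun a b c _ => ?_⟩
  · rw [intModEq_iff_cast, triProd_sum_sq h4]
    push_cast
    rfl
  · simp only [← ZMod.intCast_zmod_eq_zero_iff_dvd, intModEq_iff_cast, Int.cast_neg,
      legendreSym_cast hn] at h ⊢
    push_cast at h ⊢
    obtain ⟨⟨ha, hc⟩, hs⟩ : ((a : ZMod p) ≠ 0 ∧ (c : ZMod p) ≠ 0) ∧ (a : ZMod p) + b + c ≠ 0 := by
      simpa [mul_eq_zero, not_or] using h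
    refine ⟨fun hD => ?_, fun hD => ?_⟩
    · rw [triProd_cast_of_discr_eq_zero hn hc hD, signFactor_of_ne ha, signFactor_of_ne hs,
        neg_mul_neg, ← mul_pow, neg_mul_neg]
    · rw [triProd_cast_of_discr_ne_zero hn hc hD, signFactor_of_ne ha, signFactor_of_ne hs,
        mul_assoc, neg_mul_neg, ← mul_pow, neg_mul_neg, neg_mul, ← mul_pow]
      congr 2
      ring
  · rw [hhalf]
    have ha : (a : ZMod p) ≠ 0 := fun h0 => h (by
      rw [← ZMod.intCast_zmod_eq_zero_iff_dvd]; push_cast; rw [h0, zero_mul, zero_mul])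
    have hc : (c : ZMod p) = -a := by
      rw [eq_neg_iff_add_eq_zero, ← Int.cast_add, add_comm, hac, Int.cast_zero]
    exact boxProd_of_legendreSym hn ha hc
  · simp only [← ZMod.intCast_zmod_eq_zero_iff_dvd, intModEq_iff_cast, hhalf'] at hac hs ⊢
    push_cast [legendreSym_cast hn] at hac hs ⊢
    obtain ⟨ha, hc⟩ := mul_ne_zero_iff.1 hac
    -- The ratio `1` is a root, so the discriminant is `(a - c)²`.
    have hD : (b : ZMod p) ^ 2 - 4 * a * c = (a - c) * (a - c) := by
      linear_combination ((b : ZMod p) - a - c) * hs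
    refine ⟨fun hne => ?_, fun heq => ?_⟩
    · rw [triProd_cast_of_discr_ne_zero hn hc (by rw [hD]; exact mul_ne_zero hne hne), hD, hs,
        signFactor_zero, signFactor_of_ne ha,
        neg_one_pow_gaussCount_quot hn ha hc (sub_ne_zero.1 hne)]
      have e1 : (c : ZMod p) - a = (-1) * (a - c) := by ring
      rw [e1, neg_pow]
      simp only [mul_pow]
      linear_combination (-((c : ZMod p) ^ n * (a : ZMod p) ^ n
        * (-1) ^ n * ((a : ZMod p) - c) ^ n * ((a : ZMod p) - c) ^ n)) * htwo
    · rw [triProd_cast_of_discr_eq_zero hn hc (by rw [hD, heq, mul_zero]), hs, signFactor_zero,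
        signFactor_of_ne ha, neg_pow]
      ring
  · simp only [← ZMod.intCast_zmod_eq_zero_iff_dvd, intModEq_iff_cast, hhalf']
    push_cast [legendreSym_cast hn]
    refine ⟨fun ha hb hc => ?_, fun ha hbc hs => ?_, fun ha hbcs => ?_, fun ha hb hc => ?_,
      fun ha hb hc => ?_, fun hab hs hc => ?_, fun habs hc => ?_⟩
    · rw [triProd_cast_linear hn hc hb, ha, signFactor_zero, zero_add, signFactor_of_ne hb,
        neg_pow (b : ZMod p)]
      linear_combination -(b : ZMod p) ^ n * hone
    · obtain ⟨hb, hc⟩ := mul_ne_zero_iff.1 hbc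
      have hD : (b : ZMod p) ^ 2 - 4 * a * c = b * b := by rw [ha]; ring
      rw [triProd_cast_of_discr_ne_zero hn hc (by rw [hD]; exact mul_ne_zero hb hb), hD, ha,
        zero_add, hs, signFactor_zero, mul_pow, mul_pow, pow_half_sq hn hb, mul_one, mul_one,
        mul_one]
    · obtain ⟨hbc, hs⟩ := mul_ne_zero_iff.1 hbcs
      obtain ⟨hb, hc⟩ := mul_ne_zero_iff.1 hbc
      have hD : (b : ZMod p) ^ 2 - 4 * a * c = b * b := by rw [ha]; ring
      have hq := neg_one_pow_gaussCount_quot hn (a := -c) (c := b)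
        (by push_cast; exact neg_ne_zero.2 hc) hb
        (by push_cast; intro h0; exact hs (by rw [← h0]; ring))
      push_cast at hq
      rw [triProd_cast_of_discr_ne_zero hn hc (by rw [hD]; exact mul_ne_zero hb hb), hD, ha,
        zero_add, signFactor_zero, signFactor_of_ne hs, hq, sub_neg_eq_add, neg_pow, mul_pow,
        mul_pow, mul_pow, mul_pow, pow_half_sq hn hb, neg_pow (c : ZMod p)]
      linear_combination (-(-1 : ZMod p) ^ n * (c : ZMod p) ^ n * ((b : ZMod p) + c) ^ n) * htwo
    · have hD : (b : ZMod p) ^ 2 - 4 * a * c = 0 := by rw [ha, hb]; ring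
      rw [triProd_cast_of_discr_eq_zero hn hc hD, ha, hb, signFactor_zero, zero_add, zero_add,
        signFactor_of_ne hc, neg_pow]
      ring
    · rw [triProd_cast_const hn hc hb, signFactor_of_ne ha, neg_pow]
      ring
    · obtain ⟨ha, hb⟩ := mul_ne_zero_iff.1 hab
      rw [triProd_cast_linear hn hc hb, hs, signFactor_zero, signFactor_of_ne ha,
        eq_neg_of_add_eq_zero_left hs, neg_neg]
      ring
    · obtain ⟨hab, hs⟩ := mul_ne_zero_iff.1 habs
      obtain ⟨ha, hb⟩ := mul_ne_zero_iff.1 hab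
      have hq := neg_one_pow_gaussCount_quot hn (a := -a) (c := b)
        (by push_cast; exact neg_ne_zero.2 ha) hb
        (by push_cast; intro h0; exact hs (by rw [← h0]; ring))
      push_cast at hq
      rw [triProd_cast_linear hn hc hb, signFactor_of_ne ha, signFactor_of_ne hs, hq,
        sub_neg_eq_add, neg_pow, mul_pow, mul_pow, neg_pow (a : ZMod p), neg_pow ((a : ZMod p) + b),
        add_comm (b : ZMod p)]
      linear_combination ((-1 : ZMod p) ^ n * (a : ZMod p) ^ n * ((a : ZMod p) + b) ^ n)
        * (hone - htwo)
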